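/- **Theorem (Fidelity and Channel Discrimination).** Let $\mathcal H_{\mathrm{in}}=\mathbb C^{d}$ and $\mathcal H_{\mathrm{out}}=\mathbb C^{d'}$ with $1\le d<\infty$ and $d'<\infty$, and let $\mathcal E,\mathcal F$ be quantum channels from $\mathcal H_{\mathrm{in}}$ to $\mathcal H_{\mathrm{out}}$, that is, completely positive trace-preserving linear maps from $d\times d$ to $d'\times d'$ complex matrices. For density matrices $\rho,\sigma$ on the same space let $$F(\rho,\sigma)=\Big(\operatorname{Tr}\sqrt{\sqrt{\rho}\,\sigma\sqrt{\rho}}\Big)^2,\qquad d_{\mathrm B}(\rho,\sigma)=\sqrt{2\big(1-\sqrt{F(\rho,\sigma)}\big)}$$ be the fidelity and the Bures distance, and for a channel $\Phi$ with input space $\mathbb C^{d}$ let $$J_\Phi=\frac1d\sum_{i,j=1}^{d}|i\rangle\langle j|\otimes\Phi(|i\rangle\langle j|)$$ be its (normalized) Choi state. Then the maximum of $F\big(\mathcal E(|\psi\rangle\langle\psi|),\mathcal F(|\psi\rangle\langle\psi|)\big)$ over all unit vectors $\psi\in\mathcal H_{\mathrm{in}}$ is attained, and $$\max_{\|\psi\|=1}F\big(\mathcal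 E(|\psi\rangle\langle\psi|),\mathcal F(|\psi\rangle\langle\psi|)\big)\;\ge\;\Big(1-\tfrac12 d_{\mathrm B}^2(J_{\mathcal E},J_{\mathcal F})\Big)^2=F(J_{\mathcal E},J_{\mathcal F}).$$ -/

import Mathlib

open scoped CStarAlgebra ComplexOrder MatrixOrder Matrix.Norms.L2Operator Kronecker

noncomputable section

/-- A quantum channel from the system with Hilbert space `ℂⁿ` to the system with Hilbert space
`ℂᵐ`: a linear map of matrix algebras that is completely positive and trace preserving. -/
structure QuantumChannel (n m : Type*) [Fintype n] [DecidableEq n] [Fintype m] [DecidableEq m] where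
  /-- The underlying completely positive linear map. -/
  toCPMap : Matrix n n ℂ →CP Matrix m m ℂ
  /-- The map preserves the trace. -/
  trace_map : ∀ X : Matrix n n ℂ, (toCPMap X).trace = X.trace

/-- The rank-one operator `|ψ⟩⟨ψ|`, with entries `ψ i * conj (ψ j)`. -/
def pureState {n : Type*} (ψ : EuclideanSpace ℂ n) : Matrix n n ℂ :=
  Matrix.vecMulVec ψ.ofLp (star ψ.ofLp)

/-- The (Uhlmann) fidelity `F(ρ, σ) = (Tr √(√ρ σ √ρ))²` of two density matrices. -/
def fidelity {n : Type*} [Fintype n] [DecidableEq n] (ρ σ : Matrix n n ℂ) : ℝ :=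
  (CFC.sqrt (CFC.sqrt ρ * σ * CFC.sqrt ρ)).trace.re ^ 2

/-- The Bures distance `d_B(ρ, σ) = √(2 (1 - √F(ρ, σ)))` of two density matrices. -/
def buresDist {n : Type*} [Fintype n] [DecidableEq n] (ρ σ : Matrix n n ℂ) : ℝ :=
  √(2 * (1 - √(fidelity ρ σ)))

/-- The Choi state `(1/d) ∑ i j, |i⟩⟨j| ⊗ Φ(|i⟩⟨j|)` of a channel `Φ` with `d`-dimensional input,
i.e. the output of `id ⊗ Φ` on the maximally entangled state. -/
def QuantumChannel.choiState {n m : Type*} [Fintype n] [DecidableEq n] [Fintype m] [DecidableEq m]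
    (Φ : QuantumChannel n m) : Matrix (n × m) (n × m) ℂ :=
  (Fintype.card n : ℂ)⁻¹ •
    ∑ i, ∑ j, Matrix.single i j (1 : ℂ) ⊗ₖ Φ.toCPMap (Matrix.single i j (1 : ℂ))

end

/-! A basis vector already does the job. The diagonal blocks of `J_Φ` are `Φ(|i⟩⟨i|)/d`, and √F does
not decrease under pinching to diagonal blocks, so `√F(J_E, J_F)` is at most the average over `i` of
the output root fidelities; some `i` reaches the average. Pinching follows from `2√F(ρ, σ) = min_P
(Tr ρP + Tr σP⁻¹)` over `P > 0`: a block-diagonal `P` sees only the diagonal blocks. The positive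
definite case (`two_mul_rootFidelity_le`, `exists_posDef_trace_eq_rootFidelity`) passes to the limit
by continuity. The maximum exists by compactness of the sphere. -/

noncomputable section

open Matrix Filter Topology

/-! ### Variational formula and pinching for the root fidelity -/

section RootFidelity

variable {n m : Type*} [Fintype n] [DecidableEq n] [Fintype m] [DecidableEq m]

/-- The square-root fidelity `Tr √(√ρ σ √ρ)`. -/
def rootFidelity (ρ σ : Matrix n n ℂ) : ℝ :=
  (CFC.sqrt (CFC.sqrt ρ * σ * CFC.sqrt ρ)).trace.re

theorem fidelity_eq_rootFidelity_sq (ρ σ : Matrix n n ℂ) :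
    fidelity ρ σ = rootFidelity ρ σ ^ 2 := rfl

theorem Matrix.posSemidef_cfcSqrt (ρ : Matrix n n ℂ) : (CFC.sqrt ρ).PosSemidef :=
  nonneg_iff_posSemidef.1 (CFC.sqrt_nonneg ρ)

theorem Matrix.PosSemidef.cfcSqrt_mul_self {ρ : Matrix n n ℂ} (hρ : ρ.PosSemidef) :
    CFC.sqrt ρ * CFC.sqrt ρ = ρ :=
  CFC.sqrt_mul_sqrt_self ρ hρ.nonneg

theorem Matrix.PosSemidef.trace_re_nonneg {k : Type*} [Fintype k] {ρ : Matrix k k ℂ} (hρ : ρ.PosSemidef) :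
    0 ≤ ρ.trace.re :=
  (Complex.le_def.1 hρ.trace_nonneg).1

theorem rootFidelity_nonneg (ρ σ : Matrix n n ℂ) : 0 ≤ rootFidelity ρ σ :=
  (posSemidef_cfcSqrt _).trace_re_nonneg

theorem Matrix.PosSemidef.cfcSqrt_conj (ρ : Matrix n n ℂ) {σ : Matrix n n ℂ}
    (hσ : σ.PosSemidef) : (CFC.sqrt ρ * σ * CFC.sqrt ρ).PosSemidef := by
  have h := hσ.mul_mul_conjTranspose_same (CFC.sqrt ρ)
  rwa [(posSemidef_cfcSqrt ρ).isHermitian.eq] at h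

theorem Continuous.rootFidelity {X : Type*} [TopologicalSpace X] {f g : X → Matrix n n ℂ}
    (hf : Continuous f) (hg : Continuous g) (hf0 : ∀ x, (f x).PosSemidef)
    (hg0 : ∀ x, (g x).PosSemidef) : Continuous fun x => rootFidelity (f x) (g x) := by
  have h1 : Continuous fun x => CFC.sqrt (f x) :=
    CFC.continuousOn_sqrt.comp_continuous hf fun x => (hf0 x).nonneg
  have h2 : Continuous fun x => CFC.sqrt (CFC.sqrt (f x) * g x * CFC.sqrt (f x)) :=
    CFC.continuousOn_sqrt.comp_continuous ((h1.mul hg).mul h1)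
      fun x => ((hg0 x).cfcSqrt_conj (f x)).nonneg
  exact Complex.continuous_re.comp h2.matrix_trace

theorem rootFidelity_smul {c : ℝ} (hc : 0 ≤ c) {ρ σ : Matrix n n ℂ} (hρ : ρ.PosSemidef)
    (hσ : σ.PosSemidef) :
    rootFidelity ((c : ℂ) • ρ) ((c : ℂ) • σ) = c * rootFidelity ρ σ := by
  have hs : (0 : ℂ) ≤ ((√c : ℝ) : ℂ) := by exact_mod_cast Real.sqrt_nonneg c
  have hss : ((√c : ℝ) : ℂ) * ((√c : ℝ) : ℂ) = c := by exact_mod_cast Real.mul_self_sqrt hc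
  have hc' : (0 : ℂ) ≤ (c : ℂ) := by exact_mod_cast hc
  have h1 : CFC.sqrt ((c : ℂ) • ρ) = ((√c : ℝ) : ℂ) • CFC.sqrt ρ := by
    refine CFC.sqrt_unique ?_ ((posSemidef_cfcSqrt ρ).smul hs).nonneg
    rw [smul_mul_smul_comm, hρ.cfcSqrt_mul_self, hss]
  have h2 : CFC.sqrt (CFC.sqrt ((c : ℂ) • ρ) * ((c : ℂ) • σ) * CFC.sqrt ((c : ℂ) • ρ)) =
      (c : ℂ) • CFC.sqrt (CFC.sqrt ρ * σ * CFC.sqrt ρ) := by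
    refine CFC.sqrt_unique ?_ ((posSemidef_cfcSqrt _).smul hc').nonneg
    rw [smul_mul_smul_comm, (hσ.cfcSqrt_conj ρ).cfcSqrt_mul_self, h1, smul_mul_smul_comm,
      smul_mul_smul_comm, mul_right_comm, hss]
  rw [rootFidelity, h2, trace_smul, smul_eq_mul, Complex.re_ofReal_mul, rootFidelity]

theorem Matrix.PosDef.isUnit_cfcSqrt {ρ : Matrix n n ℂ} (hρ : ρ.PosDef) :
    IsUnit (CFC.sqrt ρ) :=
  (CFC.isUnit_sqrt_iff ρ hρ.posSemidef.nonneg).2 hρ.isUnit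

theorem Matrix.PosDef.cfcSqrt {ρ : Matrix n n ℂ} (hρ : ρ.PosDef) : (CFC.sqrt ρ).PosDef :=
  (posSemidef_cfcSqrt ρ).posDef_iff_isUnit.2 hρ.isUnit_cfcSqrt

theorem Matrix.PosDef.conj_posDef {P R : Matrix n n ℂ} (hP : P.PosDef) (hR : R.PosDef) :
    (R * P * R).PosDef := by
  have h := (Matrix.IsUnit.posDef_star_right_conjugate_iff hR.isUnit (x := P)).2 hP
  rwa [star_eq_conjTranspose, hR.isHermitian.eq] at h

/-- Completing the square: with `S = √(√ρ σ √ρ)` and `Q = √ρ P √ρ`, expand `Tr (S - Q) Q⁻¹ (S - Q) ≥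
0`. -/
theorem two_mul_rootFidelity_le {ρ σ P : Matrix n n ℂ} (hρ : ρ.PosDef) (hσ : σ.PosSemidef)
    (hP : P.PosDef) :
    2 * rootFidelity ρ σ ≤ (ρ * P).trace.re + (σ * P⁻¹).trace.re := by
  set R := CFC.sqrt ρ with hR
  have hRd : R.PosDef := hρ.cfcSqrt
  have hRR : R * R = ρ := hρ.posSemidef.cfcSqrt_mul_self
  have hRu : IsUnit R.det := (isUnit_iff_isUnit_det R).1 hRd.isUnit
  set S := CFC.sqrt (R * σ * R) with hS
  have hSS : S * S = R * σ * R := (hσ.cfcSqrt_conj ρ).cfcSqrt_mul_self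
  have hSh : Sᴴ = S := (posSemidef_cfcSqrt _).isHermitian.eq
  set Q := R * P * R with hQ
  have hQd : Q.PosDef := hP.conj_posDef hRd
  have hQu : IsUnit Q.det := (isUnit_iff_isUnit_det Q).1 hQd.isUnit
  have hpos : ((S - Q) * Q⁻¹ * (S - Q)).PosSemidef := by
    have h := hQd.inv.posSemidef.mul_mul_conjTranspose_same (S - Q)
    rwa [conjTranspose_sub, hSh, hQd.isHermitian.eq] at h
  have hexp : (S - Q) * Q⁻¹ * (S - Q) = S * Q⁻¹ * S - S - S + Q := by
    rw [sub_mul, mul_nonsing_inv Q hQu, sub_mul, mul_sub, one_mul, mul_assoc S Q⁻¹ Q,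
      nonsing_inv_mul Q hQu, mul_one]
    abel
  have hQtr : Q.trace = (ρ * P).trace := by
    rw [hQ, mul_assoc, trace_mul_comm, mul_assoc, hRR, trace_mul_comm]
  have hStr : (S * Q⁻¹ * S).trace = (σ * P⁻¹).trace := by
    rw [trace_mul_comm, ← mul_assoc, hSS, hQ, Matrix.mul_inv_rev, Matrix.mul_inv_rev]
    have : R * σ * R * (R⁻¹ * (P⁻¹ * R⁻¹)) = R * (σ * P⁻¹ * R⁻¹) := by
      simp only [mul_assoc, mul_nonsing_inv_cancel_left _ _ hRu]
    rw [this, trace_mul_comm, mul_assoc, nonsing_inv_mul R hRu, mul_one]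
  have h0 := hpos.trace_re_nonneg
  rw [hexp, trace_add, trace_sub, trace_sub, hQtr, hStr] at h0
  simp only [Complex.add_re, Complex.sub_re] at h0
  have : rootFidelity ρ σ = S.trace.re := rfl
  linarith

theorem exists_posDef_trace_eq_rootFidelity {ρ σ : Matrix n n ℂ} (hρ : ρ.PosDef)
    (hσ : σ.PosDef) :
    ∃ P : Matrix n n ℂ, P.PosDef ∧ (ρ * P).trace.re = rootFidelity ρ σ ∧
      (σ * P⁻¹).trace.re = rootFidelity ρ σ := by
  set R := CFC.sqrt ρ with hR
  have hRd : R.PosDef := hρ.cfcSqrt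
  have hRR : R * R = ρ := hρ.posSemidef.cfcSqrt_mul_self
  have hRu : IsUnit R.det := (isUnit_iff_isUnit_det R).1 hRd.isUnit
  have hXd : (R * σ * R).PosDef := hσ.conj_posDef hRd
  set S := CFC.sqrt (R * σ * R) with hS
  have hSd : S.PosDef := hXd.cfcSqrt
  have hSS : S * S = R * σ * R := hXd.posSemidef.cfcSqrt_mul_self
  have hSu : IsUnit S.det := (isUnit_iff_isUnit_det S).1 hSd.isUnit
  -- This `P` solves `R * P * R = S`, the equality case `Q = S` of the square above.
  refine ⟨R⁻¹ * S * R⁻¹, hSd.conj_posDef hRd.inv, ?_, ?_⟩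
  · change _ = S.trace.re
    rw [← hRR, mul_assoc R R, ← mul_assoc R (R⁻¹ * S), ← mul_assoc R R⁻¹,
      mul_nonsing_inv R hRu, one_mul, trace_mul_comm, mul_assoc, nonsing_inv_mul R hRu, mul_one]
  · change _ = S.trace.re
    rw [Matrix.mul_inv_rev, Matrix.mul_inv_rev, nonsing_inv_nonsing_inv R hRu, ← mul_assoc R, ← mul_assoc σ,
      trace_mul_comm, ← mul_assoc, ← mul_assoc, ← hSS, mul_assoc, mul_nonsing_inv S hSu, mul_one]

/-- `blockDiagonal` puts the block index second, Choi states put it first; hence the swap. -/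
theorem trace_mul_blockDiagonal {l : Type*} [Fintype l] (A : Matrix (n × l) (n × l) ℂ)
    (P : n → Matrix l l ℂ) :
    (A * (blockDiagonal P).submatrix Prod.swap Prod.swap).trace =
      ∑ i, (A.submatrix (Prod.mk i) (Prod.mk i) * P i).trace := by
  simp only [trace, diag, mul_apply, Fintype.sum_prod_type, submatrix_apply, Prod.swap,
    blockDiagonal_apply]
  refine Finset.sum_congr rfl fun i _ => Finset.sum_congr rfl fun a _ => ?_
  rw [Finset.sum_eq_single i] <;> simp +contextual

theorem blockDiagonal_swap_mul_inv {P : n → Matrix m m ℂ} (hP : ∀ i, (P i).PosDef) :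
    ((blockDiagonal P).submatrix Prod.swap Prod.swap : Matrix (n × m) (n × m) ℂ) *
      (blockDiagonal fun i => (P i)⁻¹).submatrix Prod.swap Prod.swap = 1 := by
  have h : ∀ i, P i * (P i)⁻¹ = 1 := fun i =>
    mul_nonsing_inv _ ((isUnit_iff_isUnit_det _).1 (hP i).isUnit)
  rw [← submatrix_mul _ _ _ _ _ Prod.swap_bijective, ← blockDiagonal_mul]
  simp only [h]
  rw [← Pi.one_def, blockDiagonal_one, submatrix_one _ Prod.swap_injective]

theorem Matrix.PosDef.blockDiagonal_swap {P : n → Matrix m m ℂ} (hP : ∀ i, (P i).PosDef) :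
    ((blockDiagonal P).submatrix Prod.swap Prod.swap : Matrix (n × m) (n × m) ℂ).PosDef := by
  have hpsd : (blockDiagonal P).PosSemidef := by
    have h := posSemidef_conjTranspose_mul_self (blockDiagonal fun i => CFC.sqrt (P i))
    rw [blockDiagonal_conjTranspose, ← blockDiagonal_mul] at h
    simpa only [(posSemidef_cfcSqrt _).isHermitian.eq, (hP _).posSemidef.cfcSqrt_mul_self] using h
  exact (hpsd.submatrix _).posDef_iff_isUnit.2
    (IsUnit.of_mul_eq_one _ (blockDiagonal_swap_mul_inv hP))

theorem Matrix.PosDef.diagonalBlock {k l : Type*} {A : Matrix (k × l) (k × l) ℂ} (hA : A.PosDef)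
    (i : k) :
    (A.submatrix (Prod.mk i) (Prod.mk i)).PosDef :=
  hA.submatrix (Prod.mk_right_injective i)

/-- The square-root fidelity does not decrease under pinching to diagonal blocks. -/
theorem rootFidelity_le_sum_diagonalBlock_of_posDef {A B : Matrix (n × m) (n × m) ℂ}
    (hA : A.PosDef) (hB : B.PosDef) :
    rootFidelity A B ≤ ∑ i, rootFidelity (A.submatrix (Prod.mk i) (Prod.mk i))
      (B.submatrix (Prod.mk i) (Prod.mk i)) := by
  choose P hP hPA hPB using fun i =>
    exists_posDef_trace_eq_rootFidelity (hA.diagonalBlock i) (hB.diagonalBlock i)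
  -- Test the pair `A`, `B` with the blockwise optimizers assembled into one matrix.
  have h := two_mul_rootFidelity_le hA hB.posSemidef (PosDef.blockDiagonal_swap hP)
  rw [inv_eq_right_inv (blockDiagonal_swap_mul_inv hP), trace_mul_blockDiagonal, trace_mul_blockDiagonal,
    Complex.re_sum, Complex.re_sum] at h
  simp only [hPA, hPB] at h
  linarith

/-- With `|t|` the perturbation stays positive for every real `t`, so continuity holds on all of
`ℝ`. -/
theorem Matrix.PosSemidef.add_smul_one {k : Type*} [DecidableEq k]
    {ρ : Matrix k k ℂ} (hρ : ρ.PosSemidef) (t : ℝ) :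
    (ρ + ((|t| : ℝ) : ℂ) • (1 : Matrix k k ℂ)).PosSemidef :=
  hρ.add (PosSemidef.one.smul (by exact_mod_cast abs_nonneg t))

theorem Matrix.PosSemidef.add_smul_one_posDef {k : Type*} [DecidableEq k]
    {ρ : Matrix k k ℂ} (hρ : ρ.PosSemidef) {t : ℝ}
    (ht : 0 < t) : (ρ + ((|t| : ℝ) : ℂ) • (1 : Matrix k k ℂ)).PosDef :=
  PosDef.posSemidef_add hρ (PosDef.one.smul (by exact_mod_cast abs_pos.2 ht.ne'))

theorem continuous_add_abs_smul_one {k : Type*} [DecidableEq k]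
    (ρ : Matrix k k ℂ) :
    Continuous fun t : ℝ => ρ + ((|t| : ℝ) : ℂ) • (1 : Matrix k k ℂ) := by
  fun_prop

/-- An inequality between continuous functions that holds on `(0, ∞)` holds at `0`. -/
theorem le_at_zero_of_forall_pos {f g : ℝ → ℝ} (hf : Continuous f) (hg : Continuous g)
    (h : ∀ t, 0 < t → f t ≤ g t) : f 0 ≤ g 0 :=
  le_of_tendsto_of_tendsto (hf.tendsto 0 |>.mono_left nhdsWithin_le_nhds)
    (hg.tendsto 0 |>.mono_left (nhdsWithin_le_nhds (s := Set.Ioi 0)))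
    (eventually_nhdsWithin_of_forall h)

theorem rootFidelity_le_sum_diagonalBlock {A B : Matrix (n × m) (n × m) ℂ}
    (hA : A.PosSemidef) (hB : B.PosSemidef) :
    rootFidelity A B ≤ ∑ i, rootFidelity (A.submatrix (Prod.mk i) (Prod.mk i))
      (B.submatrix (Prod.mk i) (Prod.mk i)) := by
  have hcA := continuous_add_abs_smul_one A
  have hcB := continuous_add_abs_smul_one B
  have h := le_at_zero_of_forall_pos
    (hcA.rootFidelity hcB hA.add_smul_one hB.add_smul_one)
    (continuous_finsetSum Finset.univ fun i _ =>
      (hcA.matrix_submatrix (Prod.mk i) (Prod.mk i)).rootFidelity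
        (hcB.matrix_submatrix (Prod.mk i) (Prod.mk i))
        (fun t => (hA.add_smul_one t).submatrix _) (fun t => (hB.add_smul_one t).submatrix _))
    (fun t ht => rootFidelity_le_sum_diagonalBlock_of_posDef (hA.add_smul_one_posDef ht)
      (hB.add_smul_one_posDef ht))
  simpa using h

/-- The variational bound at `P = 1`. -/
theorem two_mul_rootFidelity_le_trace {ρ σ : Matrix n n ℂ} (hρ : ρ.PosSemidef)
    (hσ : σ.PosSemidef) : 2 * rootFidelity ρ σ ≤ ρ.trace.re + σ.trace.re := by
  have hc := continuous_add_abs_smul_one ρ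
  have h := le_at_zero_of_forall_pos
    ((hc.rootFidelity continuous_const hρ.add_smul_one fun _ => hσ).const_mul 2)
    ((Complex.continuous_re.comp hc.matrix_trace).add continuous_const)
    (fun t ht => by
      simpa using two_mul_rootFidelity_le (hρ.add_smul_one_posDef ht) hσ PosDef.one)
  simpa using h

end RootFidelity

/-! ### Choi states of channels -/

section Channel

variable {n m : Type*} [Fintype n] [DecidableEq n] [Fintype m] [DecidableEq m]

theorem pureState_posSemidef {k : Type*} [Fintype k] (ψ : EuclideanSpace ℂ k) : (pureState ψ).PosSemidef :=
  posSemidef_vecMulVec_self_star _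

theorem pureState_single {k : Type*} [DecidableEq k] (i : k) :
    pureState (EuclideanSpace.single i (1 : ℂ)) = Matrix.single i i (1 : ℂ) := by
  ext a b
  simp only [pureState, vecMulVec_apply, single_apply, Pi.star_apply, PiLp.ofLp_single]
  by_cases ha : i = a <;> by_cases hb : i = b <;> simp [Pi.single_apply, ha, hb, eq_comm]

theorem continuous_pureState {k : Type*} :
    Continuous (pureState : EuclideanSpace ℂ k → Matrix k k ℂ) := by
  unfold pureState
  fun_prop

theorem exists_eq_star_mul_self_of_nonneg {A : Type*} [NonUnitalCStarAlgebra A] [PartialOrder A]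
    [StarOrderedRing A] {a : A} (ha : 0 ≤ a) : ∃ b, a = star b * b :=
  CStarAlgebra.nonneg_iff_eq_star_mul_self.1 ha

namespace QuantumChannel

variable (Φ : QuantumChannel n m)

theorem map_posSemidef {X : Matrix n n ℂ} (hX : X.PosSemidef) : (Φ.toCPMap X).PosSemidef :=
  nonneg_iff_posSemidef.1 (map_nonneg Φ.toCPMap hX.nonneg)

theorem continuous_toCPMap : Continuous Φ.toCPMap :=
  Φ.toCPMap.toLinearMap.continuous_of_finiteDimensional

theorem choiState_apply (i j : n) (a b : m) :
    Φ.choiState (i, a) (j, b) =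
      (Fintype.card n : ℂ)⁻¹ * Φ.toCPMap (Matrix.single i j (1 : ℂ)) a b := by
  simp only [choiState, Matrix.smul_apply, Matrix.sum_apply, kroneckerMap_apply, smul_eq_mul]
  rw [Finset.sum_eq_single i, Finset.sum_eq_single j] <;> simp +contextual [single_apply]

/-- The block matrix `M` of matrix units satisfies `M⋆M = dM`, so it is positive. Complete
positivity makes `(Φ(|i⟩⟨j|))` positive, hence of the form `B⋆B`; flattening `B` exhibits the Choi
state as a Gram matrix. -/
theorem choiState_posSemidef : Φ.choiState.PosSemidef := by
  set M : CStarMatrix n n (Matrix n n ℂ) :=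
    CStarMatrix.ofMatrix fun i j => Matrix.single i j (1 : ℂ) with hM
  have hMe : ∀ i j, M i j = Matrix.single i j (1 : ℂ) := fun _ _ => rfl
  have hM0 : 0 ≤ M := by
    have hstar : (Fintype.card n : ℝ) • M = star M * M := by
      ext i j : 2
      simp [hMe, CStarMatrix.mul_apply, CStarMatrix.star_apply, star_eq_conjTranspose,
        Nat.cast_smul_eq_nsmul]
    rcases isEmpty_or_nonempty n with hn | hn
    · exact (Subsingleton.elim 0 M).le
    have hM' : M = (Fintype.card n : ℝ)⁻¹ • (star M * M) := by
      rw [← hstar, inv_smul_smul₀ (Nat.cast_ne_zero.2 Fintype.card_ne_zero)]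
    rw [hM']
    exact smul_nonneg (by positivity) (star_mul_self_nonneg M)
  obtain ⟨B, hB⟩ := exists_eq_star_mul_self_of_nonneg
    (Φ.toCPMap.map_cstarMatrix_nonneg M hM0)
  have hent : ∀ i j, Φ.toCPMap (Matrix.single i j (1 : ℂ)) = ∑ k, (B k i)ᴴ * B k j := fun i j => by
    have h := congrFun (congrFun hB i) j
    simpa [hMe, CStarMatrix.mul_apply, CStarMatrix.star_apply, star_eq_conjTranspose] using h
  have hchoi : Φ.choiState = (Fintype.card n : ℂ)⁻¹ •
      ((of fun p q : n × m => B p.1 q.1 p.2 q.2)ᴴ * of fun p q : n × m => B p.1 q.1 p.2 q.2) := by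
    ext ⟨i, a⟩ ⟨j, b⟩
    rw [choiState_apply, hent]
    simp [Matrix.sum_apply, mul_apply, Fintype.sum_prod_type]
  rw [hchoi]
  exact (posSemidef_conjTranspose_mul_self _).smul (by positivity)

theorem choiState_diagonalBlock (i : n) :
    Φ.choiState.submatrix (Prod.mk i) (Prod.mk i) =
      (((Fintype.card n : ℝ)⁻¹ : ℝ) : ℂ) •
        Φ.toCPMap (pureState (EuclideanSpace.single i (1 : ℂ))) := by
  ext a b
  simp [choiState_apply, pureState_single]

theorem choiState_trace [Nonempty n] : Φ.choiState.trace = 1 := by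
  have h : ∀ i, ∑ a, Φ.toCPMap (Matrix.single i i (1 : ℂ)) a a = 1 := fun i => by
    have := Φ.trace_map (Matrix.single i i (1 : ℂ))
    simpa [trace] using this
  simp only [trace, diag, Fintype.sum_prod_type, choiState_apply, ← Finset.mul_sum, h]
  simp

end QuantumChannel

theorem rootFidelity_choiState_le_one [Nonempty n] (E F : QuantumChannel n m) :
    rootFidelity E.choiState F.choiState ≤ 1 := by
  have h := two_mul_rootFidelity_le_trace E.choiState_posSemidef F.choiState_posSemidef
  rw [E.choiState_trace, F.choiState_trace, Complex.one_re] at h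
  linarith

theorem exists_rootFidelity_choiState_le [Nonempty n] (E F : QuantumChannel n m) :
    ∃ i : n, rootFidelity E.choiState F.choiState ≤
      rootFidelity (E.toCPMap (pureState (EuclideanSpace.single i (1 : ℂ))))
        (F.toCPMap (pureState (EuclideanSpace.single i (1 : ℂ)))) := by
  have h := rootFidelity_le_sum_diagonalBlock E.choiState_posSemidef F.choiState_posSemidef
  simp only [QuantumChannel.choiState_diagonalBlock] at h
  simp only [rootFidelity_smul (inv_nonneg.2 (Nat.cast_nonneg (Fintype.card n)))
    (E.map_posSemidef (pureState_posSemidef _)) (F.map_posSemidef (pureState_posSemidef _)),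
    ← Finset.mul_sum] at h
  by_contra! hlt
  have hsum := Finset.sum_lt_sum_of_nonempty Finset.univ_nonempty fun i _ => hlt i
  have hn : (0 : ℝ) < Fintype.card n := by exact_mod_cast Fintype.card_pos
  rw [Finset.sum_const, Finset.card_univ, nsmul_eq_mul] at hsum
  rw [inv_mul_eq_div, le_div_iff₀ hn] at h
  linarith

theorem one_sub_half_buresDist_sq [Nonempty n] (E F : QuantumChannel n m) :
    1 - 1 / 2 * buresDist E.choiState F.choiState ^ 2 =
      rootFidelity E.choiState F.choiState := by
  rw [buresDist, fidelity_eq_rootFidelity_sq, Real.sqrt_sq (rootFidelity_nonneg _ _),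
    -- Root fidelity at most 1 keeps the radicand of `buresDist` nonnegative, where `√` is not
    -- truncated.
    Real.sq_sqrt (by linarith [rootFidelity_choiState_le_one E F])]
  ring

theorem isCompact_unit_vectors {k : Type*} [Fintype k] :
    IsCompact {ψ : EuclideanSpace ℂ k | ‖ψ‖ = 1} := by
  simpa [Metric.sphere] using isCompact_sphere (0 : EuclideanSpace ℂ k) 1

end Channel

end

theorem mainTheorem12 {n m : Type*} [Fintype n] [DecidableEq n] [Nonempty n]
    [Fintype m] [DecidableEq m] (E F : QuantumChannel n m) :
    (∃ M : ℝ,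
      IsGreatest {r : ℝ | ∃ ψ : EuclideanSpace ℂ n, ‖ψ‖ = 1 ∧
        r = fidelity (E.toCPMap (pureState ψ)) (F.toCPMap (pureState ψ))} M ∧
      (1 - 1 / 2 * buresDist E.choiState F.choiState ^ 2) ^ 2 ≤ M) ∧
    (1 - 1 / 2 * buresDist E.choiState F.choiState ^ 2) ^ 2 =
      fidelity E.choiState F.choiState := by
  rw [one_sub_half_buresDist_sq]
  refine ⟨?_, rfl⟩
  have hcont : Continuous fun ψ : EuclideanSpace ℂ n =>
      fidelity (E.toCPMap (pureState ψ)) (F.toCPMap (pureState ψ)) :=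
    ((E.continuous_toCPMap.comp continuous_pureState).rootFidelity
      (F.continuous_toCPMap.comp continuous_pureState)
      (fun ψ => E.map_posSemidef (pureState_posSemidef ψ))
      (fun ψ => F.map_posSemidef (pureState_posSemidef ψ))).pow 2
  obtain ⟨i, hi⟩ := exists_rootFidelity_choiState_le E F
  have hunit : ‖(EuclideanSpace.single i (1 : ℂ) : EuclideanSpace ℂ n)‖ = 1 := by simp
  -- The basis vector serves twice: it makes the sphere nonempty and bounds the maximum from below.
  obtain ⟨ψ, hψ, hmax⟩ := isCompact_unit_vectors.exists_isMaxOn ⟨_, hunit⟩ hcont.continuousOn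
  refine ⟨_, ⟨⟨ψ, hψ, rfl⟩, ?_⟩, ?_⟩
  · rintro r ⟨φ, hφ, rfl⟩
    exact hmax hφ
  · exact (pow_le_pow_left₀ (rootFidelity_nonneg _ _) hi 2).trans (hmax hunit)
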